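/- Let $v,k,t,\ell$ be non-negative integers with $0\le t\le k\le v/2$. For $i\ge 0$ let $A^i_{kk}$ be the matrix whose rows and columns are indexed by the $k$-subsets of a $v$-set and whose entry at $(S,K)$ is $\binom{|S\cap K|}{i}$. Put $F^t_{kk}(z)=\sum_{i=0}^t A^i_{kk}z^i$, and let $U^{t\ell}_{kk}$ be the coefficient of $(z+1)^\ell$ in the expansion $F^t_{kk}(z)=\sum_{\ell=0}^t U^{t\ell}_{kk}(z+1)^\ell$ (so $U^{t\ell}_{kk}=0$ if $\ell>t$). For $0\le j\le t$ let $$\lambda_j=\sum_{i=\ell}^{t}(-1)^{\ell+i}\binom{i}{\ell}\binom{k-j}{i-j}\binom{v-j-i}{k-i},$$ where a binomial coefficient with negative lower index is $0$. Then the eigenvalues of the real symmetric matrix $U^{t\ell}_{kk}$, counted with multiplicity, are $$\lambda_0^{\binom v0},\ \lambda_1^{\binom v1-\binom v0},\ \ldots,\ \lambda_t^{\binom vt-\binom v{t-1}},\ 0^{\binom vk-\binom vt},$$ where exponents indicate multiplicities (the multiplicities of coinciding values are added). -/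

import Mathlib

namespace IntersectionMatrix

/-- The `k`-subsets of the `v`-set `Fin v`. -/
abbrev KSubset (v k : ℕ) : Type := {S : Finset (Fin v) // S.card = k}

/-- The matrix `A_{sk}^i(v)`, with entries `C(|S ∩ K|, i)`. -/
def A (v s k i : ℕ) : Matrix (KSubset v s) (KSubset v k) ℝ :=
  Matrix.of fun S K => ((S.1 ∩ K.1).card.choose i : ℝ)

open Polynomial in
/-- The polynomial matrix `F_{sk}^t(v)(z) = ∑_{i=0}^t A_{sk}^i(v) z^i`. -/
noncomputable def F (v s k t : ℕ) : Matrix (KSubset v s) (KSubset v k) ℝ[X] :=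
  ∑ i ∈ Finset.range (t + 1), (X ^ i : ℝ[X]) • (A v s k i).map C

open Polynomial in
/-- The matrix `U_{sk}^{t ℓ}(v)`: the coefficient of `(z + 1)^ℓ` in `F_{sk}^t(v)(z)`,
i.e. the `ℓ`-th Taylor coefficient at `z = -1` of each entry. -/
noncomputable def U (v s k t ℓ : ℕ) : Matrix (KSubset v s) (KSubset v k) ℝ :=
  (F v s k t).map fun p => (taylor (-1) p).coeff ℓ

theorem F_apply (v s k t : ℕ) (S : KSubset v s) (K : KSubset v k) :
    F v s k t S K = ∑ i ∈ Finset.range (t + 1),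
      (Polynomial.X ^ i * Polynomial.C ((S.1 ∩ K.1).card.choose i : ℝ)) := by
  simp [F, A, Matrix.sum_apply]

open Polynomial in
/-- The defining expansion `F_{sk}^t(z) = ∑_{ℓ=0}^t U_{sk}^{t ℓ} (z + 1)^ℓ`. -/
theorem F_eq_sum_U (v s k t : ℕ) :
    F v s k t = ∑ ℓ ∈ Finset.range (t + 1), ((X + 1) ^ ℓ : ℝ[X]) • (U v s k t ℓ).map C := by
  ext1 S K
  have hdeg : (taylor (-1) (F v s k t S K)).natDegree < t + 1 := by
    rw [natDegree_taylor, F_apply, Nat.lt_succ_iff]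
    refine natDegree_sum_le_of_forall_le _ _ fun i hi => ?_
    refine (natDegree_mul_C_le _ _).trans ?_
    rw [natDegree_X_pow]
    exact Nat.lt_succ_iff.mp (Finset.mem_range.mp hi)
  have h := sum_taylor_eq (F v s k t S K) (-1)
  rw [sum_over_range' _ (by simp) _ hdeg] at h
  rw [← h, Matrix.sum_apply]
  refine Finset.sum_congr rfl fun ℓ _ => ?_
  simp [U, mul_comm]

/-- `U_{kk}^{t ℓ}` is a real symmetric matrix, so that the algebraic and the geometric
multiplicities of its eigenvalues agree. -/
theorem U_isSymm (v k t ℓ : ℕ) : (U v k k t ℓ).IsSymm := by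
  ext S K
  simp only [Matrix.transpose_apply, U, Matrix.map_apply, F_apply, Finset.inter_comm]

/-- `λ_j = ∑_{i=ℓ}^t (-1)^(ℓ+i) C(i,ℓ) C(k-j,i-j) C(v-j-i,k-i)`, where `C(k-j,i-j) = 0` for
`i < j`. It is used for `j ≤ t ≤ k` and `2k ≤ v`, where no other subtraction truncates. -/
noncomputable def eigenvalue (v k t ℓ j : ℕ) : ℝ :=
  ∑ i ∈ Finset.Icc ℓ t, (-1 : ℝ) ^ (ℓ + i) * (i.choose ℓ : ℝ) *
    (if j ≤ i then ((k - j).choose (i - j) : ℝ) else 0) * ((v - j - i).choose (k - i) : ℝ)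

/-- `C(v,j) - C(v,j-1)`, where `C(v,-1) = 0`. It is used for `2j ≤ v`, where the
subtraction does not truncate. -/
def multiplicity (v j : ℕ) : ℕ :=
  v.choose j - (if j = 0 then 0 else v.choose (j - 1))

end IntersectionMatrix

namespace IntersectionMatrix

open Finset Matrix

/-! Write `W` for the inclusion matrix of `k`-subsets in `(k+1)`-subsets. The proof computes the
spectrum of every combination `∑ c_i A^i` by induction on `k`, without eigenvectors. Since `A^i` is
the Gram matrix of an inclusion matrix, the level `k+1` combination is `Wᵀ M W + c_{k+1} I` for a
level `k` combination `M` (`combination_succ`). Swapping factors, `Wᵀ (M W)` has the eigenvalues of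
`M W Wᵀ` and `C(v,k+1) - C(v,k)` further zeros. Finally `M W Wᵀ` is again a level `k` combination
(`combination_lowerCoeff`), so induction applies. The claimed eigenvalues are linear in `c` and obey
the same recursion by Pascal's rule (`eigenvalueFactor_succ`). Taking for `c` the Taylor
coefficients of `z^i` at `-1`, cut off at `t`, gives `U`. -/

/-! ### Products of inclusion matrices -/

theorem card_KSubset (v k : ℕ) : Fintype.card (KSubset v k) = v.choose k := by
  simp

/-- The number of `m`-subsets lying between two given sets. -/
theorem card_between {v m : ℕ} {X Y : Finset (Fin v)} (hXY : X ⊆ Y) (hm : #X ≤ m) :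
    #{M : KSubset v m | X ⊆ M.1 ∧ M.1 ⊆ Y} = (#Y - #X).choose (m - #X) := by
  rw [← card_sdiff_of_subset hXY, ← card_powersetCard]
  refine card_bij (fun M _ => M.1 \ X) ?_ ?_ ?_
  · intro M hM
    obtain ⟨h1, h2⟩ := (mem_filter.1 hM).2
    rw [mem_powersetCard, card_sdiff_of_subset h1, M.2]
    exact ⟨sdiff_subset_sdiff h2 subset_rfl, rfl⟩
  · intro M hM N hN h
    have h1 := (mem_filter.1 hM).2.1
    have h2 := (mem_filter.1 hN).2.1
    apply Subtype.ext
    rw [← sdiff_union_of_subset h1, ← sdiff_union_of_subset h2]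
    exact congrArg (· ∪ X) h
  · intro T hT
    obtain ⟨hT, hc⟩ := mem_powersetCard.1 hT
    have hd : Disjoint T X := disjoint_of_subset_left hT sdiff_disjoint
    refine ⟨⟨T ∪ X, ?_⟩, ?_, ?_⟩
    · rw [card_union_of_disjoint hd, hc]; omega
    · exact mem_filter.2 ⟨mem_univ _, subset_union_right,
        union_subset (hT.trans sdiff_subset) hXY⟩
    · exact union_sdiff_cancel_right hd

/-- The inclusion matrix of `i`-subsets versus `k`-subsets. -/
def inclusion (v i k : ℕ) : Matrix (KSubset v i) (KSubset v k) ℝ :=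
  Matrix.of fun I K => if I.1 ⊆ K.1 then 1 else 0

theorem inclusion_transpose_mul (v s k i : ℕ) :
    (inclusion v i s)ᵀ * inclusion v i k = A v s k i := by
  ext S K
  have h := card_between (m := i) (empty_subset (S.1 ∩ K.1)) (by simp)
  simp only [empty_subset, true_and, card_empty, Nat.sub_zero] at h
  simp only [mul_apply, transpose_apply, inclusion, A, of_apply, ← ite_and, mul_ite, mul_one,
    mul_zero]
  rw [sum_boole, ← h]
  simp only [subset_inter_iff, and_comm]

theorem inclusion_mul (v : ℕ) {i m k : ℕ} (him : i ≤ m) :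
    inclusion v i m * inclusion v m k = ((k - i).choose (m - i) : ℝ) • inclusion v i k := by
  ext I K
  simp only [mul_apply, inclusion, of_apply, ← ite_and, mul_ite, mul_one, mul_zero, Matrix.smul_apply,
    smul_eq_mul]
  rw [sum_boole]
  split_ifs with h
  · have := card_between (m := m) h (by rw [I.2]; exact him)
    rw [I.2, K.2] at this
    rw [← this]
    simp only [and_comm]
  · rw [Nat.cast_eq_zero, card_eq_zero, filter_eq_empty_iff]
    exact fun M _ hM => h (hM.2.trans hM.1)

/-- The entry counts the `(m+1)`-sets containing `I ∪ S`: any point outside `S` may be added if `I ⊆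
S`, and the union is the only choice if `I` has one point outside `S`. -/
theorem inclusion_mul_transpose_apply (v : ℕ) {i m : ℕ} (I : KSubset v i) (S : KSubset v m) :
    (inclusion v i (m + 1) * (inclusion v m (m + 1))ᵀ) I S =
      if I.1 ⊆ S.1 then ((v - m : ℕ) : ℝ) else if #(I.1 \ S.1) = 1 then 1 else 0 := by
  simp only [mul_apply, transpose_apply, inclusion, of_apply, ← ite_and, mul_ite, mul_one,
    mul_zero]
  rw [sum_boole]
  have hc : #(I.1 ∪ S.1) = #(I.1 \ S.1) + m := by
    rw [← card_sdiff_add_card, S.2]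
  by_cases hle : #(I.1 ∪ S.1) ≤ m + 1
  · have h := card_between (m := m + 1) (subset_univ (I.1 ∪ S.1)) hle
    have hf : #{K : KSubset v (m + 1) | S.1 ⊆ K.1 ∧ I.1 ⊆ K.1} =
        (v - #(I.1 ∪ S.1)).choose (m + 1 - #(I.1 ∪ S.1)) := by
      simpa [union_subset_iff, and_comm] using h
    rw [hf]
    split_ifs with h1 h2
    · rw [union_eq_right.2 h1, S.2]; simp
    · rw [hc, h2]; simp [add_comm]
    · have h0 : #(I.1 \ S.1) ≠ 0 := by rwa [Ne, card_eq_zero, sdiff_eq_empty_iff_subset]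
      omega
  · have h1 : ¬ I.1 ⊆ S.1 := fun h => by
      rw [union_eq_right.2 h, S.2] at hle; omega
    rw [if_neg h1, if_neg (by omega), Nat.cast_eq_zero, card_eq_zero, filter_eq_empty_iff]
    intro K _ hK
    apply hle
    rw [← K.2]
    exact card_le_card (union_subset hK.2 hK.1)

theorem inclusion_zero_mul_transpose (v m : ℕ) (hm : m ≤ v) :
    inclusion v 0 (m + 1) * (inclusion v m (m + 1))ᵀ = ((v : ℝ) - m) • inclusion v 0 m := by
  ext I S
  have : I.1 ⊆ S.1 := by rw [card_eq_zero.1 I.2]; exact empty_subset _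
  rw [inclusion_mul_transpose_apply, if_pos this]
  simp [inclusion, this, Nat.cast_sub hm]

/-- The last product has entry `C(|I ∩ S|, i)`, which is `i + 1` when `I ⊆ S`, `1` when one point of
`I` is missing, and `0` otherwise. The scalar corrects the first case. -/
theorem inclusion_succ_mul_transpose (v : ℕ) {i m : ℕ} (hm : m ≤ v) :
    inclusion v (i + 1) (m + 1) * (inclusion v m (m + 1))ᵀ =
      ((v : ℝ) - m - (i + 1)) • inclusion v (i + 1) m +
        (inclusion v i (i + 1))ᵀ * inclusion v i m := by
  ext I S
  rw [inclusion_mul_transpose_apply, inclusion_transpose_mul]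
  have hc := card_sdiff_add_card_inter I.1 S.1
  rw [I.2] at hc
  simp only [inclusion, A, Matrix.add_apply, Matrix.smul_apply, of_apply, smul_eq_mul]
  split_ifs with h1 h2
  · rw [inter_eq_left.2 h1, I.2]
    simp [Nat.cast_sub hm]
  · rw [show #(I.1 ∩ S.1) = i by omega]
    simp
  · have h0 : #(I.1 \ S.1) ≠ 0 := by rwa [Ne, card_eq_zero, sdiff_eq_empty_iff_subset]
    rw [Nat.choose_eq_zero_of_lt (by omega)]
    simp

theorem inclusion_mul_succ (v : ℕ) {i m : ℕ} (him : i ≤ m) :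
    inclusion v i m * inclusion v m (m + 1) = ((m : ℝ) + 1 - i) • inclusion v i (m + 1) := by
  rw [inclusion_mul v him]
  obtain ⟨d, rfl⟩ := Nat.exists_eq_add_of_le him
  rw [show i + d + 1 - i = d + 1 by omega, show i + d - i = d by omega, Nat.choose_succ_self_right]
  push_cast
  congr 1
  ring

theorem inclusion_succ_mul (v : ℕ) {i m : ℕ} (him : i + 1 ≤ m) :
    inclusion v i (i + 1) * inclusion v (i + 1) m = ((m : ℝ) - i) • inclusion v i m := by
  rw [inclusion_mul v (Nat.le_succ i), show i + 1 - i = 1 by omega, Nat.choose_one_right,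
    Nat.cast_sub (by omega)]

theorem A_succ_eq (v : ℕ) {i m : ℕ} (him : i ≤ m) :
    (inclusion v m (m + 1))ᵀ * A v m m i * inclusion v m (m + 1) =
      ((m : ℝ) + 1 - i) ^ 2 • A v (m + 1) (m + 1) i := by
  rw [← inclusion_transpose_mul, ← inclusion_transpose_mul, Matrix.mul_assoc, Matrix.mul_assoc,
    inclusion_mul_succ v him, ← Matrix.mul_assoc, ← Matrix.transpose_mul,
    inclusion_mul_succ v him, transpose_smul, Matrix.smul_mul, Matrix.mul_smul, smul_smul, sq]

theorem A_zero_mul_gram (v : ℕ) {m : ℕ} (hm : m ≤ v) :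
    A v m m 0 * (inclusion v m (m + 1) * (inclusion v m (m + 1))ᵀ) =
      (((m : ℝ) + 1) * (v - m)) • A v m m 0 := by
  rw [← inclusion_transpose_mul, Matrix.mul_assoc, ← Matrix.mul_assoc (inclusion v 0 m),
    inclusion_mul_succ v (Nat.zero_le m), Matrix.smul_mul, inclusion_zero_mul_transpose v m hm,
    smul_smul, Matrix.mul_smul]
  simp

/-- The span of the `A^i` is stable under `W Wᵀ`, which acts bidiagonally; this is what closes the
induction. -/
theorem A_succ_mul_gram (v : ℕ) {i m : ℕ} (hm : m ≤ v) (him : i + 1 ≤ m) :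
    A v m m (i + 1) * (inclusion v m (m + 1) * (inclusion v m (m + 1))ᵀ) =
      (((m : ℝ) - i) * (v - m - (i + 1))) • A v m m (i + 1) +
        ((m : ℝ) - i) ^ 2 • A v m m i := by
  rw [← inclusion_transpose_mul, Matrix.mul_assoc, ← Matrix.mul_assoc (inclusion v (i + 1) m),
    inclusion_mul_succ v him, Matrix.smul_mul, inclusion_succ_mul_transpose v hm, Matrix.mul_smul,
    Matrix.mul_add, ← Matrix.mul_assoc, ← Matrix.transpose_mul, inclusion_succ_mul v him,
    transpose_smul, Matrix.smul_mul, Matrix.mul_smul, inclusion_transpose_mul, inclusion_transpose_mul,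
    smul_add, smul_smul, smul_smul]
  push_cast
  congr 2 <;> ring

theorem A_self (v k : ℕ) : A v k k k = 1 := by
  ext S K
  simp only [A, of_apply, one_apply]
  split_ifs with h
  · simp [h, K.2]
  · rw [Nat.choose_eq_zero_of_lt, Nat.cast_zero]
    by_contra hlt
    rw [not_lt] at hlt
    have h1 := eq_of_subset_of_card_le inter_subset_left (S.2.trans_le hlt)
    have h2 := eq_of_subset_of_card_le inter_subset_right (K.2.trans_le hlt)
    exact h (Subtype.ext (h1.symm.trans h2))

/-! ### Descent from level `k+1` to level `k` -/

/-- The linear combination `∑_{i ≤ k} c_i A_{kk}^i`. -/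
noncomputable def combination (v k : ℕ) (c : ℕ → ℝ) : Matrix (KSubset v k) (KSubset v k) ℝ :=
  ∑ i ∈ range (k + 1), c i • A v k k i

/-- The eigenvalue of `∑_{i ≤ k} c_i A_{kk}^i` of index `j`. -/
noncomputable def combinationEigenvalue (v k : ℕ) (c : ℕ → ℝ) (j : ℕ) : ℝ :=
  ∑ i ∈ range (k + 1), c i * (if j ≤ i then ((k - j).choose (i - j) : ℝ) else 0) *
    ((v - j - i).choose (k - i) : ℝ)

/-- The coefficients that `c` induces one level below. -/
noncomputable def lowerCoeff (v k : ℕ) (c : ℕ → ℝ) (i : ℕ) : ℝ :=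
  c i * ((v - k - i) / (k + 1 - i)) + if i < k then c (i + 1) else 0

theorem combination_lowerCoeff (v k : ℕ) (c : ℕ → ℝ) (hk : k ≤ v) :
    combination v k (fun i => c i / ((k : ℝ) + 1 - i) ^ 2) *
      (inclusion v k (k + 1) * (inclusion v k (k + 1))ᵀ) = combination v k (lowerCoeff v k c) := by
  have h1 : combination v k (lowerCoeff v k c) =
      ∑ i ∈ range (k + 1), (c i * ((v - k - i) / (k + 1 - i))) • A v k k i +
        ∑ i ∈ range k, c (i + 1) • A v k k i := by
    simp only [combination, lowerCoeff, add_smul, sum_add_distrib]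
    congr 1
    rw [sum_range_succ, if_neg (lt_irrefl k), zero_smul, add_zero]
    exact sum_congr rfl fun i hi => by rw [if_pos (mem_range.1 hi)]
  -- With `i = 0` split off, the term `A^{i+1}` on the left yields both `A^{i+1}` and `A^i`; its
  -- weight `1/(k-i)²` cancels the factor of `A^i`.
  rw [h1, combination, Matrix.sum_mul, sum_range_succ', sum_range_succ', add_right_comm,
    ← sum_add_distrib]
  congr 1
  · refine sum_congr rfl fun i hi => ?_
    have hi : i + 1 ≤ k := mem_range.1 hi
    have h0 : (k : ℝ) - i ≠ 0 := by
      rw [sub_ne_zero, Ne, Nat.cast_inj]; omega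
    have h2 : (k : ℝ) + 1 - (i + 1 : ℕ) = k - i := by push_cast; ring
    rw [smul_mul, A_succ_mul_gram v hk hi, smul_add, smul_smul, smul_smul, h2]
    congr 2
    · push_cast; field_simp
    · field_simp
  · rw [smul_mul, A_zero_mul_gram v hk, smul_smul]
    congr 1
    have : (k : ℝ) + 1 ≠ 0 := by positivity
    push_cast
    simp only [sub_zero]
    field_simp

/-- The top term is `c_{k+1} I`; every other `A^i` factors through level `k` at the cost of
`(k+1-i)²`. The form and bracketing suit the scalar shift and the swap of factors in
`charpoly_combination`. -/
theorem combination_succ (v k : ℕ) (c : ℕ → ℝ) :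
    combination v (k + 1) c =
      (inclusion v k (k + 1))ᵀ * (combination v k (fun i => c i / ((k : ℝ) + 1 - i) ^ 2) *
        inclusion v k (k + 1)) - Matrix.scalar _ (-c (k + 1)) := by
  rw [combination, sum_range_succ, A_self, combination, Matrix.sum_mul, Matrix.mul_sum,
    sub_eq_add_neg, ← map_neg, neg_neg]
  congr 1
  · refine sum_congr rfl fun i hi => ?_
    have hi : i < k + 1 := mem_range.1 hi
    have h0 : (k : ℝ) + 1 - i ≠ 0 := by
      rw [sub_ne_zero]; exact_mod_cast hi.ne'
    rw [smul_mul, Matrix.mul_smul, ← Matrix.mul_assoc, A_succ_eq v (by omega), smul_smul,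
      div_mul_cancel₀ _ (pow_ne_zero 2 h0)]
  · rw [Matrix.smul_one_eq_diagonal]; rfl


/-! ### Recurrence for the eigenvalues -/

theorem cast_choose_succ_mul (n m : ℕ) :
    (n.choose (m + 1) : ℝ) * (m + 1) = n.choose m * ((n : ℝ) - m) := by
  rcases le_or_gt m n with h | h
  · rw [← Nat.cast_sub h]
    exact_mod_cast Nat.choose_succ_right_eq n m
  · simp [Nat.choose_eq_zero_of_lt h, Nat.choose_eq_zero_of_lt (h.trans (Nat.lt_succ_self m))]

/-- This is the generic case `j ≤ i < k` of `eigenvalueFactor_succ`, with `x = k - i - 1`, `y = i -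
j` and `n = v - j - (i + 1)`. -/
theorem choose_mul_choose_recurrence (n x y : ℕ) :
    ((x + y + 2).choose (y + 1) : ℝ) * n.choose (x + 1) =
      ((n : ℝ) - x - y - 1) / (x + 1) * (x + y + 1).choose (y + 1) * n.choose x +
        (x + y + 1).choose y * (n + 1).choose (x + 1) := by
  have h0 : (x : ℝ) + 1 ≠ 0 := by positivity
  have h1 := cast_choose_succ_mul (x + y + 1) y
  have h2 := cast_choose_succ_mul n x
  rw [Nat.choose_succ_succ' (x + y + 1) y, Nat.choose_succ_succ' n x]
  push_cast at h1 ⊢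
  rw [← eq_div_iff h0] at h2
  rw [h2]
  field_simp
  linear_combination (n.choose x : ℝ) * h1

/-- The factor of `c_i` in the eigenvalue of index `j`. -/
noncomputable def eigenvalueFactor (v k j i : ℕ) : ℝ :=
  (if j ≤ i then ((k - j).choose (i - j) : ℝ) else 0) * ((v - j - i).choose (k - i) : ℝ)

theorem eigenvalueFactor_zero (v k j : ℕ) (hj : j ≤ k) :
    eigenvalueFactor v (k + 1) j 0 = ((v : ℝ) - k) / (k + 1) * eigenvalueFactor v k j 0 := by
  rcases Nat.eq_zero_or_pos j with rfl | h
  · have h0 : (k : ℝ) + 1 ≠ 0 := by positivity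
    have h := cast_choose_succ_mul v k
    rw [← eq_div_iff h0] at h
    simp [eigenvalueFactor, h]
    ring
  · simp [eigenvalueFactor, h.ne']

theorem eigenvalueFactor_succ {v k j i : ℕ} (hkv : 2 * (k + 1) ≤ v) (hi : i < k) (hj : j ≤ k) :
    eigenvalueFactor v (k + 1) j (i + 1) =
      ((v : ℝ) - k - (i + 1)) / (k - i) * eigenvalueFactor v k j (i + 1) +
        eigenvalueFactor v k j i := by
  obtain ⟨x, rfl⟩ := Nat.exists_eq_add_of_lt hi
  -- At `j = i + 1` the generic identity would need `y = -1`; there the level `i` factor vanishes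
  -- and absorption suffices. For larger `j` everything vanishes.
  rcases lt_trichotomy j (i + 1) with h | rfl | h
  · obtain ⟨y, rfl⟩ := Nat.exists_eq_add_of_le (Nat.lt_succ_iff.1 h)
    obtain ⟨n, rfl⟩ : ∃ n, v = n + (j + y) + j + 1 := ⟨v - (j + y) - j - 1, by omega⟩
    have := choose_mul_choose_recurrence n x y
    simp only [eigenvalueFactor, if_pos (show j ≤ j + y + 1 by omega),
      if_pos (show j ≤ j + y by omega)]
    rw [show j + y + x + 1 + 1 - j = x + y + 2 by omega, show j + y + 1 - j = y + 1 by omega,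
      show n + (j + y) + j + 1 - j - (j + y + 1) = n by omega,
      show j + y + x + 1 + 1 - (j + y + 1) = x + 1 by omega,
      show j + y + x + 1 - j = x + y + 1 by omega,
      show j + y + x + 1 - (j + y + 1) = x by omega,
      show j + y - j = y by omega, show n + (j + y) + j + 1 - j - (j + y) = n + 1 by omega,
      show j + y + x + 1 - (j + y) = x + 1 by omega, this]
    push_cast
    rw [← mul_assoc]
    congr 4 <;> ring
  · obtain ⟨n, rfl⟩ : ∃ n, v = n + 2 * (i + 1) := ⟨v - 2 * (i + 1), by omega⟩
    have h0 : (x : ℝ) + 1 ≠ 0 := by positivity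
    have h2 := cast_choose_succ_mul n x
    rw [← eq_div_iff h0] at h2
    simp only [eigenvalueFactor, le_refl, if_true, if_neg (show ¬ i + 1 ≤ i by omega)]
    rw [show n + 2 * (i + 1) - (i + 1) - (i + 1) = n by omega,
      show i + x + 1 + 1 - (i + 1) = x + 1 by omega, show i + x + 1 - (i + 1) = x by omega, h2]
    simp only [Nat.sub_self, Nat.choose_zero_right]
    push_cast
    rw [show (i : ℝ) + x + 1 - i = x + 1 by ring]
    ring
  · simp [eigenvalueFactor, if_neg (show ¬ j ≤ i + 1 by omega), if_neg (show ¬ j ≤ i by omega)]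

theorem combinationEigenvalue_eq (v k : ℕ) (c : ℕ → ℝ) (j : ℕ) :
    combinationEigenvalue v k c j = ∑ i ∈ range (k + 1), c i * eigenvalueFactor v k j i :=
  sum_congr rfl fun _ _ => mul_assoc _ _ _

theorem eigenvalueFactor_self {v k j : ℕ} (hj : j ≤ k) : eigenvalueFactor v k j k = 1 := by
  simp [eigenvalueFactor, hj]

theorem combinationEigenvalue_succ {v k j : ℕ} (hkv : 2 * (k + 1) ≤ v) (c : ℕ → ℝ) (hj : j ≤ k) :
    combinationEigenvalue v (k + 1) c j =
      combinationEigenvalue v k (lowerCoeff v k c) j + c (k + 1) := by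
  rw [combinationEigenvalue_eq, combinationEigenvalue_eq, sum_range_succ,
    eigenvalueFactor_self (by omega), mul_one]
  congr 1
  have h : ∑ i ∈ range (k + 1), lowerCoeff v k c i * eigenvalueFactor v k j i =
      ∑ i ∈ range (k + 1), c i * ((v - k - i) / (k + 1 - i)) * eigenvalueFactor v k j i +
        ∑ i ∈ range k, c (i + 1) * eigenvalueFactor v k j i := by
    simp only [lowerCoeff, add_mul, sum_add_distrib]
    congr 1
    rw [sum_range_succ, if_neg (lt_irrefl k), zero_mul, add_zero]
    exact sum_congr rfl fun i hi => by rw [if_pos (mem_range.1 hi)]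
  rw [h, sum_range_succ', sum_range_succ', add_right_comm, ← sum_add_distrib]
  congr 1
  · refine sum_congr rfl fun i hi => ?_
    rw [eigenvalueFactor_succ hkv (mem_range.1 hi) hj]
    push_cast
    rw [show (k : ℝ) + 1 - (i + 1) = k - i by ring]
    ring
  · rw [eigenvalueFactor_zero v k j hj]
    simp [mul_assoc]

theorem combinationEigenvalue_self (v k : ℕ) (c : ℕ → ℝ) :
    combinationEigenvalue v k c k = c k := by
  rw [combinationEigenvalue_eq, sum_range_succ, eigenvalueFactor_self le_rfl, mul_one,
    sum_eq_zero, zero_add]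
  intro i hi
  simp [eigenvalueFactor, (mem_range.1 hi).not_ge]

/-! ### Characteristic polynomial -/

open Polynomial in
theorem charpoly_combination (v k : ℕ) (hkv : 2 * k ≤ v) (c : ℕ → ℝ) :
    (combination v k c).charpoly = ∏ j ∈ Finset.range (k + 1),
      (X - C (combinationEigenvalue v k c j)) ^ multiplicity v j := by
  induction k generalizing c with
  | zero =>
    have h : combination v 0 c = Matrix.scalar _ (c 0) := by
      rw [combination, sum_range_one, A_self, Matrix.smul_one_eq_diagonal]; rfl
    rw [h, prod_range_one, combinationEigenvalue_self]
    simp [Matrix.charpoly_diagonal, multiplicity]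
  | succ k ih =>
    have hcard : v.choose k ≤ v.choose (k + 1) :=
      Nat.choose_le_succ_of_lt_half_left (by omega)
    -- The swap contributes `X ^ (C(v,k+1) - C(v,k))`, which the shift by `c_{k+1}` turns into the
    -- new factor, of index `j = k + 1`; the shift also adds `c_{k+1}` to every older eigenvalue.
    rw [combination_succ, Matrix.charpoly_sub_scalar, Matrix.charpoly_mul_comm_of_le _ _
      (by rw [card_KSubset, card_KSubset]; exact hcard), Matrix.mul_assoc,
      combination_lowerCoeff v k c (by omega), ih (by omega), prod_range_succ _ (k + 1),
      combinationEigenvalue_self, card_KSubset, card_KSubset, mul_comp, mul_comm,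
      Polynomial.prod_comp]
    congr 1
    · refine prod_congr rfl fun j hj => ?_
      rw [combinationEigenvalue_succ hkv c (Nat.lt_succ_iff.1 (mem_range.1 hj))]
      simp only [pow_comp, sub_comp, X_comp, C_comp, map_add, map_neg]
      congr 1
      ring
    · simp [multiplicity, sub_eq_add_neg]

/-! ### Specialisation to `U` -/

/-- The coefficient of `A_{kk}^i` in `U_{kk}^{tℓ}`. -/
def taylorCoeff (t ℓ i : ℕ) : ℝ :=
  if i ≤ t then (-1 : ℝ) ^ (ℓ + i) * (i.choose ℓ : ℝ) else 0

theorem U_eq_combination {v k t ℓ : ℕ} (htk : t ≤ k) :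
    U v k k t ℓ = combination v k (taylorCoeff t ℓ) := by
  ext S K
  rw [combination, ← sum_subset (range_subset_range.2 (Nat.succ_le_succ htk))]
  · rw [U, Matrix.map_apply, F_apply, map_sum, Polynomial.finsetSum_coeff, Matrix.sum_apply]
    refine sum_congr rfl fun i hi => ?_
    have hi : i ≤ t := Nat.lt_succ_iff.1 (mem_range.1 hi)
    rw [Polynomial.taylor_mul, Polynomial.taylor_C, Polynomial.coeff_mul_C,
      Polynomial.taylor_X_pow, Polynomial.coeff_X_add_C_pow, Matrix.smul_apply, taylorCoeff,
      if_pos hi, smul_eq_mul]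
    simp only [A, of_apply]
    rcases le_or_gt ℓ i with h | h
    · obtain ⟨d, rfl⟩ := Nat.exists_eq_add_of_le h
      -- The Taylor sign is `(-1)^(i-ℓ)`, which equals `(-1)^(ℓ+i)` because the exponents differ by
      -- `2ℓ`.
      rw [show ℓ + d - ℓ = d by omega, ← add_assoc, pow_add _ (ℓ + ℓ), ← two_mul, pow_mul]
      simp
    · simp [Nat.choose_eq_zero_of_lt h]
  · intro i _ hi
    rw [taylorCoeff, if_neg (by simpa using hi), zero_smul]

theorem combinationEigenvalue_taylorCoeff {v k t ℓ : ℕ} (htk : t ≤ k) (j : ℕ) :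
    combinationEigenvalue v k (taylorCoeff t ℓ) j = eigenvalue v k t ℓ j := by
  rw [combinationEigenvalue, eigenvalue]
  symm
  apply sum_subset_zero_on_sdiff
  · intro i hi
    rw [mem_Icc] at hi
    exact mem_range.2 (by omega)
  · intro i hi
    rw [mem_sdiff, mem_Icc, not_and_or] at hi
    rcases hi.2 with h | h
    · simp [taylorCoeff, Nat.choose_eq_zero_of_lt (not_le.1 h)]
    · simp [taylorCoeff, h]
  · intro i hi
    rw [taylorCoeff, if_pos (mem_Icc.1 hi).2]

theorem eigenvalue_of_lt {v k t ℓ j : ℕ} (h : t < j) : eigenvalue v k t ℓ j = 0 := by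
  refine sum_eq_zero fun i hi => ?_
  rw [if_neg (by have := (mem_Icc.1 hi).2; omega)]
  simp

theorem sum_multiplicity {v t k : ℕ} (htk : t ≤ k) (hkv : 2 * k ≤ v) :
    ∑ j ∈ Ico (t + 1) (k + 1), multiplicity v j = v.choose k - v.choose t := by
  induction k, htk using Nat.le_induction with
  | base => simp
  | succ k htk ih =>
    have h1 : v.choose k ≤ v.choose (k + 1) :=
      Nat.choose_le_succ_of_lt_half_left (by omega)
    -- The sum telescopes; monotonicity of binomials up to the middle keeps the natural subtractions
    -- exact.
    have h2 : v.choose t ≤ v.choose k := by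
      clear ih h1
      induction k, htk using Nat.le_induction with
      | base => rfl
      | succ k htk ih =>
        exact (ih (by omega)).trans (Nat.choose_le_succ_of_lt_half_left (by omega))
    rw [sum_Ico_succ_top (by omega), ih (by omega), multiplicity, if_neg (Nat.succ_ne_zero k),
      Nat.add_sub_cancel]
    omega

end IntersectionMatrix

theorem mainTheorem2 (v k t ℓ : ℕ) (htk : t ≤ k) (hkv : 2 * k ≤ v) :
    (IntersectionMatrix.U v k k t ℓ).charpoly.roots =
      (∑ j ∈ Finset.range (t + 1),
        Multiset.replicate (IntersectionMatrix.multiplicity v j)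
          (IntersectionMatrix.eigenvalue v k t ℓ j)) +
      Multiset.replicate (v.choose k - v.choose t) (0 : ℝ) := by
  have hroots : (IntersectionMatrix.U v k k t ℓ).charpoly.roots =
      ∑ j ∈ Finset.range (k + 1), Multiset.replicate (IntersectionMatrix.multiplicity v j)
        (IntersectionMatrix.eigenvalue v k t ℓ j) := by
    rw [IntersectionMatrix.U_eq_combination htk, IntersectionMatrix.charpoly_combination v k hkv,
      Polynomial.roots_prod _ _ (Finset.prod_ne_zero_iff.2 fun j _ =>
        pow_ne_zero _ (Polynomial.X_sub_C_ne_zero _)), Multiset.bind, Multiset.join,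
      ← Finset.sum_eq_multiset_sum]
    simp only [Polynomial.roots_pow, Polynomial.roots_X_sub_C, Multiset.nsmul_singleton,
      IntersectionMatrix.combinationEigenvalue_taylorCoeff htk]
  -- The indices `t < j ≤ k` all carry the eigenvalue `0`, so their blocks merge into one.
  rw [hroots, ← Finset.sum_range_add_sum_Ico _ (Nat.succ_le_succ htk),
    ← IntersectionMatrix.sum_multiplicity htk hkv]
  congr 1
  rw [← Multiset.nsmul_singleton, ← Finset.sum_nsmul_assoc]
  refine Finset.sum_congr rfl fun j hj => ?_
  rw [IntersectionMatrix.eigenvalue_of_lt (Finset.mem_Ico.1 hj).1, Multiset.nsmul_singleton]
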